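/- Let $U$ be a universe of separations, that is, a lattice with an order-reversing involution $s\mapsto s^*$, and let $S\subseteq U$ be a finite separation system (a finite subset closed under ${}^*$) that is structurally submodular: for all $s,t\in S$, at least one of $s\vee t$ and $s\wedge t$ lies in $S$. The underlying unoriented separation of $s$ is $\{s,s^*\}$. An orientation of $S$ is a set $O\subseteq S$ that contains exactly one element of each pair $\{s,s^*\}$ with $s\in S$ (so $s\in O$ if $s=s^*\in S$). It is consistent if there are no $r,s\in O$ with $\{r,r^*\}\ne\{s,s^*\}$ and $r^*\le s$. A profile of $S$ is a consistent orientation $P$ of $S$ such that $r^*\wedge s^*\notin P$ for all $r,s\in P$; it is regular if it contains no $s$ with $s^*\le s$. A separation $s$ distinguishes two orientations $O_1,O_2$ if one of $s,s^*$ lies in $O_1$ and its inverse lies in $O_2$. A set $D$ of separations distinguishes two orientations if some element of $D$ does. For a regular profile $P$ of $S$ let $\delta(P)$ be the minimal size of a set $D\subseteq S$ that distinguishes $P$ from every other regular profile of $S$. An $S$-tree $(T,\alpha)$ is a finite tree $T$ together with a map $\alpha$ from the set of oriented edges of $T$ to $S$ with $\alpha(v,u)=\alpha(u,v)^*$. It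 is irredundant if $\alpha(t',t)\neq\alpha(t'',t)$ whenever $t',t''$ are distinct neighbours of a node $t$; it is over stars if $\alpha(t',t)\le \alpha(t'',t)^*$ whenever $t', t''$ are neighbours of a node $t$ with $\alpha(t',t)\ne\alpha(t'',t)$. A tree of tangles for $S$ is an irredundant $S$-tree whose edge labels distinguish every two distinct regular profiles of $S$. A regular profile $P$ of $S$ orients each edge $uv$ of $T$ from $u$ to $v$ if $\alpha(u,v)\in P$. If this orientation has exactly one sink (a node towards which all its incident edges are oriented), this sink is the node of $P$ in $T$, and its degree in $T$ is the degree of $P$ in $(T,\alpha)$. Theorem. There is a tree of tangles $(T,\alpha)$ for $S$, over stars, such that every regular profile $P$ of $S$ has a node in $T$ and the degree of $P$ in $(T,\alpha)$ is exactly $\delta(P)$. Furthermore, if the maximum degree $\Delta(T)$ of $T$ is greater than $3$, then $\Delta(T)=\delta(P)$ for some regular profile $P$ of $S$. -/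

import Mathlib

namespace AbstractSep

/-- A universe of (oriented) separations: a lattice with an order-reversing involution. -/
class SepUniverse (U : Type*) extends Lattice U where
  /-- the inverse of an oriented separation -/
  inv : U → U
  inv_inv : ∀ s : U, inv (inv s) = s
  inv_le_inv : ∀ s t : U, s ≤ t → inv t ≤ inv s

section Separations

variable {U : Type*} [SepUniverse U]

/-- The inverse of an oriented separation. -/
def inv (s : U) : U := SepUniverse.inv s

/-- The underlying unoriented separation of an oriented separation `s`: the pair of `s` and its
inverse. -/
def underlying (s : U) : Sym2 U := s(s, inv s)

/-- `S` is (the set of oriented separations of) a finite separation system inside the universe. -/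
structure IsSepSystem (S : Set U) : Prop where
  finite : S.Finite
  inv_mem : ∀ s ∈ S, inv s ∈ S

/-- Structural submodularity of a separation system inside a universe. -/
def IsStructurallySubmodular (S : Set U) : Prop :=
  ∀ s ∈ S, ∀ t ∈ S, s ⊔ t ∈ S ∨ s ⊓ t ∈ S

/-- A separation is small if it lies below its inverse. -/
def IsSmall (s : U) : Prop := s ≤ inv s

/-- A separation is cosmall if its inverse is small. -/
def IsCosmall (s : U) : Prop := IsSmall (inv s)

/-- A set of oriented separations is regular if it contains no cosmall separation. -/
def IsRegular (O : Set U) : Prop := ∀ s ∈ O, ¬ IsCosmall s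

/-- `O` is an orientation of `S`: an antisymmetric subset of `S` which contains at least one
orientation of every separation in `S`. -/
structure IsOrientation (S O : Set U) : Prop where
  subset : O ⊆ S
  antisymm : ∀ s ∈ S, (O ∩ {s, inv s}).Subsingleton
  total : ∀ s ∈ S, s ∈ O ∨ inv s ∈ O

/-- `O` contains no `r`, `s` with different underlying unoriented separations and
`inv r ≤ s`. -/
def IsConsistent (O : Set U) : Prop :=
  ∀ r ∈ O, ∀ s ∈ O, underlying r ≠ underlying s → ¬ inv r ≤ s

/-- `P` is a profile of `S`: a consistent orientation with the profile property. -/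
structure IsProfile (S P : Set U) : Prop where
  orientation : IsOrientation S P
  consistent : IsConsistent P
  profile : ∀ r ∈ P, ∀ s ∈ P, inv r ⊓ inv s ∉ P

/-- `P` is a regular profile of `S`. -/
structure IsRegularProfile (S P : Set U) : Prop extends IsProfile S P where
  regular : IsRegular P

/-- The separation underlying `s` distinguishes `O₁` and `O₂`: it has an orientation in `O₁`
whose inverse is in `O₂`. -/
def Distinguishes (s : U) (O₁ O₂ : Set U) : Prop :=
  (s ∈ O₁ ∧ inv s ∈ O₂) ∨ (inv s ∈ O₁ ∧ s ∈ O₂)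

/-- `D` is a set of separations in `S` that distinguishes `P` from all other regular profiles
of `S`. -/
def DistinguishesFromOthers (S P D : Set U) : Prop :=
  D ⊆ S ∧ ∀ Q : Set U, IsRegularProfile S Q → Q ≠ P → ∃ s ∈ D, Distinguishes s P Q

/-- `δ(P)`: the minimal size of a set of separations in `S` that distinguishes `P` from all other
regular profiles of `S`. -/
noncomputable def delta (S P : Set U) : ℕ :=
  sInf {n : ℕ | ∃ D : Finset U, D.card = n ∧ DistinguishesFromOthers S P (D : Set U)}

/-- A star: a set of separations whose distinct elements point towards each other. -/
def IsStar (σ : Set U) : Prop := ∀ s ∈ σ, ∀ t ∈ σ, s ≠ t → s ≤ inv t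

/-- An `S`-tree `(T, α)` with vertex set `V`: a tree `T` together with a labelling `α` of the
oriented edges of `T` by elements of `S` which commutes with the involutions. -/
structure STree (S : Set U) (V : Type*) where
  /-- the tree `T` -/
  graph : SimpleGraph V
  isTree : graph.IsTree
  /-- the labelling `α` of the oriented edges -/
  label : graph.Dart → U
  label_mem : ∀ e, label e ∈ S
  label_symm : ∀ e, label e.symm = inv (label e)

namespace STree

variable {S : Set U} {V : Type*} (T : STree S V)

/-- `α(t)`: the set of the labels of the edges at `t`, all directed towards `t`. -/
def labelsAt (t : V) : Set U := {s | ∃ e : T.graph.Dart, e.snd = t ∧ T.label e = s}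

/-- The edges from distinct neighbours of a node to that node have distinct labels. -/
def IsIrredundant : Prop :=
  ∀ e f : T.graph.Dart, e.snd = f.snd → e.fst ≠ f.fst → T.label e ≠ T.label f

/-- All the sets `α(t)` are stars. -/
def IsOverStars : Prop := ∀ t : V, IsStar (T.labelsAt t)

/-- A tree of tangles for `S`: an irredundant `S`-tree whose edge labels distinguish all regular
profiles of `S`. -/
structure IsTreeOfTangles : Prop where
  irredundant : T.IsIrredundant
  distinguishes : ∀ P Q : Set U, IsRegularProfile S P → IsRegularProfile S Q → P ≠ Q →
    ∃ e : T.graph.Dart, Distinguishes (T.label e) P Q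

/-- `t` is a sink of the orientation of the edges of `T` induced by `P` (which directs an edge as
`e` if the label of `e` is in `P`): every edge at `t` is directed towards `t`. -/
def IsSink (P : Set U) (t : V) : Prop := ∀ e : T.graph.Dart, e.snd = t → T.label e ∈ P

/-- `t` is the node of `P` in `T`: the unique sink of the orientation induced by `P`. -/
def IsNodeOf (P : Set U) (t : V) : Prop := T.IsSink P t ∧ ∀ t' : V, T.IsSink P t' → t' = t

open Classical in
/-- The degree of a node of the tree. -/
noncomputable def degree [Fintype V] (t : V) : ℕ := T.graph.degree t

open Classical in
/-- `Δ(T)`: the maximum degree of the tree. -/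
noncomputable def maxDegree [Fintype V] : ℕ := T.graph.maxDegree

end STree

end Separations

end AbstractSep

/-!
Call a star in `S` a node star if it has at most three elements or at most `δ(P)` elements for some
regular profile `P`, and if whenever it lies in a regular profile `P`, it lies in no other one and
has at most `δ(P)` elements. In an irredundant `S`-tree all of whose stars `α(t)` are node stars,
every regular profile `P` has a node `t`, and `α(t) ⊆ P` distinguishes `P` from all other regular
profiles, so that `t` has degree exactly `δ(P)`. A node of degree more than `3` has degree at most
some `δ(P)`, which is the degree of the node of `P`.

Such a tree exists by tangle-tree duality, since no regular and consistent orientation of `S` avoids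
all node stars. If the profile property fails for `r` and `s`, then by submodularity the orientation
contains `{r ⊓ inv s, s, inv r ⊓ inv s}` or the same star with `r` and `s` swapped, a node star
contained in no profile. If it holds, the orientation is a regular profile `P`, and it contains
a node star: uncrossing a smallest set that distinguishes `P` from the other regular profiles turns
it into a star.

For the duality, extend partial orientations of `S` by minimal undecided separations `r` and
`q ≤ inv r`. Trees witnessing that neither extension contains a tangle are combined by shifting them
to `s` and to `inv s`, for some separation `s` with `r ≤ s ≤ inv q`. Submodularity provides an `s`
for which all the shifted separations are in `S`, and node stars are closed under shifting.
-/

namespace AbstractSep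

section LinkedSeparations

variable {L : Type*} [Lattice L] {S : Set L} {r r' s t : L}

/-- `s` is join-linked to `r` in `S` if joining with `s` maps the part of `S` above `r` into `S`.
Such an `s` can be used to shift `S`-trees. -/
def IsJoinLinked (S : Set L) (r s : L) : Prop := ∀ t ∈ S, r ≤ t → t ⊔ s ∈ S

/-- `s` is meet-linked to `r` in `S` if meeting with `s` maps the part of `S` below `r` into `S`:
the order dual of `IsJoinLinked`. -/
def IsMeetLinked (S : Set L) (r s : L) : Prop := ∀ t ∈ S, t ≤ r → t ⊓ s ∈ S

lemma isJoinLinked_self (S : Set L) (r : L) : IsJoinLinked S r r :=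
  fun _ ht hrt => by rwa [sup_eq_left.2 hrt]

lemma isMeetLinked_self (S : Set L) (r : L) : IsMeetLinked S r r :=
  fun _ ht htr => by rwa [inf_eq_left.2 htr]

lemma IsJoinLinked.mono_left (h : IsJoinLinked S r s) (hrt : r ≤ t) : IsJoinLinked S t s :=
  fun u hu htu => h u hu (hrt.trans htu)

lemma IsJoinLinked.trans (hs : IsJoinLinked S r s) (ht : IsJoinLinked S s t) (hst : s ≤ t) :
    IsJoinLinked S r t := fun u hu hru => by
  have := ht _ (hs u hu hru) le_sup_right
  rwa [sup_assoc, sup_eq_right.2 hst] at this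

lemma IsMeetLinked.trans (hs : IsMeetLinked S r s) (ht : IsMeetLinked S s t) (hts : t ≤ s) :
    IsMeetLinked S r t := fun u hu hur => by
  have := ht _ (hs u hu hur) inf_le_right
  rwa [inf_assoc, inf_eq_right.2 hts] at this

lemma ncard_inter_Icc_lt {α : Type*} [PartialOrder α] {S : Set α} {a b c d : α} (hS : S.Finite)
    (ha : a ∈ S) (hb : b ∈ S) (hab : a ≤ b) (hac : a ≤ c) (hdb : d ≤ b) (hne : a ≠ c ∨ d ≠ b) :
    (S ∩ Set.Icc c d).ncard < (S ∩ Set.Icc a b).ncard := by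
  refine Set.ncard_lt_ncard ⟨Set.inter_subset_inter_right S (Set.Icc_subset_Icc hac hdb),
    fun hsub => ?_⟩ (hS.subset Set.inter_subset_left)
  rcases hne with hne | hne
  · exact hne (hac.antisymm (hsub ⟨ha, le_rfl, hab⟩).2.1)
  · exact hne (hdb.antisymm (hsub ⟨hb, hab, le_rfl⟩).2.2)

/-- Unless `r` is meet-linked to `r'` or `r'` is join-linked to `r`, there are `t' ≤ r'` and `r ≤ t`
with `t' ⊓ r` and `t ⊔ r'` outside `S`. By submodularity the opposite corners are in `S`, so they
must be `t' ⊔ r = r'` and `t ⊓ r' = r`, and then neither `t ⊔ t'` nor `t ⊓ t'` is in `S`. -/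
lemma isMeetLinked_or_isJoinLinked (hsub : ∀ s ∈ S, ∀ t ∈ S, s ⊔ t ∈ S ∨ s ⊓ t ∈ S)
    (hr : r ∈ S) (hr' : r' ∈ S) (h : r ≤ r')
    (hmeet : ∀ v ∈ S, r ≤ v → v ≤ r' → v ≠ r' → IsMeetLinked S v r)
    (hjoin : ∀ v ∈ S, r ≤ v → v ≤ r' → r ≠ v → IsJoinLinked S v r') :
    IsMeetLinked S r' r ∨ IsJoinLinked S r r' := by
  by_contra! hlink
  simp only [IsMeetLinked, IsJoinLinked, not_forall] at hlink
  obtain ⟨⟨t', ht', htr', hinf⟩, t, ht, hrt, hsup⟩ := hlink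
  have hsup_eq : t' ⊔ r = r' := by
    by_contra hne
    exact hinf (hmeet _ ((hsub t' ht' r hr).resolve_right hinf) le_sup_right (sup_le htr' h) hne
      t' ht' le_sup_left)
  have hinf_eq : t ⊓ r' = r := by
    by_contra hne
    exact hsup (hjoin _ ((hsub t ht r' hr').resolve_left hsup) (le_inf hrt h) inf_le_right
      (Ne.symm hne) t ht inf_le_left)
  rcases hsub t ht t' ht' with hmem | hmem
  · exact hsup (by rwa [← hsup_eq, sup_comm t' r, ← sup_assoc, sup_eq_left.2 hrt])
  · exact hinf (by rwa [← hinf_eq, inf_left_comm, inf_eq_left.2 htr'])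

/-- Induction on the number of elements of `S` in `[r, r']`: a proper join-link of `r` or a proper
meet-link of `r'` in the interval can be composed with a link in the remaining interval. -/
theorem exists_isJoinLinked_isMeetLinked (hS : S.Finite)
    (hsub : ∀ s ∈ S, ∀ t ∈ S, s ⊔ t ∈ S ∨ s ⊓ t ∈ S) (hr : r ∈ S) (hr' : r' ∈ S) (h : r ≤ r') :
    ∃ s ∈ S, r ≤ s ∧ s ≤ r' ∧ IsJoinLinked S r s ∧ IsMeetLinked S r' s := by
  induction hn : (S ∩ Set.Icc r r').ncard using Nat.strong_induction_on generalizing r r' with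
  | _ n ih =>
  subst hn
  by_contra! hnone
  have hjoin : ∀ a ∈ S, r ≤ a → a ≤ r' → IsJoinLinked S r a → a = r := by
    intro a ha hra har' hlink
    by_contra hne
    obtain ⟨s, hs, has, hsr', hjs, hms⟩ :=
      ih _ (ncard_inter_Icc_lt hS hr hr' h hra le_rfl (.inl (Ne.symm hne))) ha hr' har' rfl
    exact hnone s hs (hra.trans has) hsr' (hlink.trans hjs has) hms
  have hmeet : ∀ a ∈ S, r ≤ a → a ≤ r' → IsMeetLinked S r' a → a = r' := by
    intro a ha hra har' hlink
    by_contra hne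
    obtain ⟨s, hs, hrs, hsa, hjs, hms⟩ :=
      ih _ (ncard_inter_Icc_lt hS hr hr' h le_rfl har' (.inr hne)) hr ha hra rfl
    exact hnone s hs hrs (hsa.trans har') hjs (hlink.trans hms hsa)
  refine (isMeetLinked_or_isJoinLinked hsub hr hr' h (fun v hv hrv hvr' hne => ?_)
    fun v hv hrv hvr' hne => ?_).elim (hnone r hr le_rfl h (isJoinLinked_self S r))
    fun hlink => hnone r' hr' h le_rfl hlink (isMeetLinked_self S r')
  · obtain ⟨a, ha, hra, hav, hja, hma⟩ :=
      ih _ (ncard_inter_Icc_lt hS hr hr' h le_rfl hvr' (.inr hne)) hr hv hrv rfl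
    rwa [hjoin a ha hra (hav.trans hvr') hja] at hma
  · obtain ⟨a, ha, hva, har', hja, hma⟩ :=
      ih _ (ncard_inter_Icc_lt hS hr hr' h hrv le_rfl (.inl hne)) hv hr' hvr' rfl
    rwa [hmeet a ha (hrv.trans hva) har' hma] at hja

end LinkedSeparations

section Involution

variable {U : Type*} [SepUniverse U] {S : Set U} {r s t : U}

@[simp]
lemma inv_inv (s : U) : inv (inv s) = s := SepUniverse.inv_inv s

lemma inv_le_inv (h : s ≤ t) : inv t ≤ inv s := SepUniverse.inv_le_inv s t h

lemma le_inv_comm : s ≤ inv t ↔ t ≤ inv s :=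
  ⟨fun h => by simpa only [inv_inv] using inv_le_inv h,
    fun h => by simpa only [inv_inv] using inv_le_inv h⟩

@[simp]
lemma inv_sup (s t : U) : inv (s ⊔ t) = inv s ⊓ inv t :=
  le_antisymm (le_inf (inv_le_inv le_sup_left) (inv_le_inv le_sup_right))
    (le_inv_comm.1 (sup_le (le_inv_comm.1 inf_le_left) (le_inv_comm.1 inf_le_right)))

@[simp]
lemma inv_inf (s t : U) : inv (s ⊓ t) = inv s ⊔ inv t := by
  rw [← inv_inv (inv s ⊔ inv t), inv_sup, inv_inv, inv_inv]

lemma isCosmall_iff : IsCosmall s ↔ inv s ≤ s := by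
  simp only [IsCosmall, IsSmall, inv_inv]

lemma IsSepSystem.inv_mem_iff (hS : IsSepSystem S) : inv s ∈ S ↔ s ∈ S :=
  ⟨fun h => inv_inv s ▸ hS.inv_mem _ h, hS.inv_mem s⟩

lemma IsMeetLinked.inv (hS : IsSepSystem S) (h : IsMeetLinked S r s) :
    IsJoinLinked S (inv r) (inv s) := fun t ht hrt => by
  rw [← hS.inv_mem_iff, inv_sup, inv_inv]
  exact h _ (hS.inv_mem t ht) (by simpa using inv_le_inv hrt)

lemma IsJoinLinked.inf_inv_mem (h : IsJoinLinked S r s) (hS : IsSepSystem S) (ht : t ∈ S)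
    (hrt : r ≤ inv t) : t ⊓ inv s ∈ S := by
  rw [← hS.inv_mem_iff, inv_inf, inv_inv]
  exact h _ (hS.inv_mem t ht) hrt

theorem IsStructurallySubmodular.exists_isJoinLinked (hsub : IsStructurallySubmodular S)
    (hS : IsSepSystem S) (hr : r ∈ S) (ht : t ∈ S) (hrt : r ≤ inv t) :
    ∃ s ∈ S, r ≤ s ∧ t ≤ inv s ∧ IsJoinLinked S r s ∧ IsJoinLinked S t (inv s) := by
  obtain ⟨s, hs, hrs, hst, hjoin, hmeet⟩ :=
    exists_isJoinLinked_isMeetLinked hS.finite hsub hr (hS.inv_mem t ht) hrt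
  exact ⟨s, hs, hrs, le_inv_comm.1 hst, hjoin, by simpa using hmeet.inv hS⟩

end Involution

section Orientations

variable {U : Type*} [SepUniverse U] {S A O P : Set U} {r s : U}

/-- `A` is a subset of `S` that is closed downwards in `S`. -/
structure IsDownClosedIn (S A : Set U) : Prop where
  subset : A ⊆ S
  mem_of_le : ∀ {r s}, r ∈ S → s ∈ A → r ≤ s → r ∈ A

/-- `A` is a regular and consistent partial orientation of `S`, extended by everything it forces by
consistency. -/
structure IsPartialOrientation (S A : Set U) : Prop extends IsDownClosedIn S A where
  inv_notMem : ∀ {s}, s ∈ A → inv s ∉ A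

/-- `O` is a regular and consistent orientation of `S`. -/
structure IsRegularOrientation (S O : Set U) : Prop extends IsPartialOrientation S O where
  total : ∀ {s}, s ∈ S → s ∈ O ∨ inv s ∈ O

lemma IsPartialOrientation.not_inv_le (hA : IsPartialOrientation S A) (hS : IsSepSystem S)
    (hr : r ∈ A) (hs : s ∈ A) : ¬ inv r ≤ s := fun h =>
  hA.inv_notMem hr (hA.mem_of_le (hS.inv_mem r (hA.subset hr)) hs h)

lemma IsPartialOrientation.insert_of_minimal (hA : IsPartialOrientation S A) (hS : IsSepSystem S)
    (hr : r ∈ S) (hne : inv r ≠ r) (hrA : inv r ∉ A) (hlt : ∀ t ∈ S, t < r → t ∈ A ∨ inv t ∈ A) :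
    IsPartialOrientation S (insert r A) where
  subset := Set.insert_subset hr hA.subset
  mem_of_le := by
    rintro t s ht (rfl | hs) hts
    · rcases hts.eq_or_lt with rfl | htr
      · exact .inl rfl
      · refine .inr ((hlt t ht htr).resolve_right fun h => hrA ?_)
        exact hA.mem_of_le (hS.inv_mem _ hr) h (inv_le_inv hts)
    · exact .inr (hA.mem_of_le ht hs hts)
  inv_notMem := by
    rintro s (rfl | hs) (h | h)
    · exact hne h
    · exact hrA h
    · exact hrA (by rwa [← h, inv_inv])
    · exact hA.inv_notMem hs h

lemma exists_minimal_undecided {α : Type*} [PartialOrder α] {S : Set α} {s : α} (hS : S.Finite)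
    (p : α → Prop) (hs : s ∈ S) (hps : ¬ p s) :
    ∃ r ∈ S, r ≤ s ∧ ¬ p r ∧ ∀ t ∈ S, t < r → p t := by
  obtain ⟨r, hrs, hr⟩ :=
    (hS.subset (Set.sep_subset S fun x => ¬ p x)).exists_le_minimal ⟨hs, hps⟩
  exact ⟨r, hr.prop.1, hrs, hr.prop.2, fun t ht htr =>
    by_contra fun hpt => htr.not_ge (hr.le_of_le ⟨ht, hpt⟩ htr.le)⟩

lemma IsRegularOrientation.inv_mem_iff (hO : IsRegularOrientation S O) (hs : s ∈ S) :
    inv s ∈ O ↔ s ∉ O :=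
  ⟨fun h h' => hO.inv_notMem h' h, (hO.total hs).resolve_left⟩

lemma IsRegularOrientation.eq_of_subset (hO : IsRegularOrientation S O)
    (hP : IsRegularOrientation S P) (h : O ⊆ P) : O = P :=
  h.antisymm fun _ hs => by_contra fun hsO =>
    hP.inv_notMem hs (h ((hO.inv_mem_iff (hP.subset hs)).2 hsO))

lemma IsRegularProfile.not_inv_le (hP : IsRegularProfile S P) (hr : r ∈ P) (hs : s ∈ P) :
    ¬ inv r ≤ s := by
  intro h
  by_cases hu : underlying r = underlying s
  · rcases Sym2.eq_iff.1 hu with ⟨rfl, -⟩ | ⟨rfl, -⟩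
    · exact hP.regular r hr (isCosmall_iff.2 h)
    · have hinv : inv s = s := hP.orientation.antisymm s (hP.orientation.subset hs)
        ⟨hr, .inr rfl⟩ ⟨hs, .inl rfl⟩
      exact hP.regular s hs (isCosmall_iff.2 hinv.le)
  · exact hP.consistent r hr s hs hu h

theorem isRegularProfile_iff (hS : IsSepSystem S) :
    IsRegularProfile S P ↔
      IsRegularOrientation S P ∧ ∀ r ∈ P, ∀ s ∈ P, inv r ⊓ inv s ∉ P := by
  constructor
  · intro hP
    refine ⟨⟨⟨⟨hP.orientation.subset, fun {r s} hr hs hrs => ?_⟩,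
      fun {s} hs hs' => hP.not_inv_le hs hs' le_rfl⟩, fun {s} => hP.orientation.total s⟩,
      hP.profile⟩
    exact (hP.orientation.total r hr).resolve_right fun h => hP.not_inv_le h hs (by rwa [inv_inv])
  · rintro ⟨hO, hprof⟩
    refine ⟨⟨⟨hO.subset, ?_, fun s => hO.total⟩, fun r hr s hs _ => hO.not_inv_le hS hr hs, hprof⟩,
      fun s hs h => hO.not_inv_le hS hs hs (isCosmall_iff.1 h)⟩
    rintro s - x ⟨hx, rfl | rfl⟩ y ⟨hy, rfl | rfl⟩
    · rfl
    · exact (hO.inv_notMem hx hy).elim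
    · exact (hO.inv_notMem hy hx).elim
    · rfl

lemma IsRegularProfile.isRegularOrientation (hP : IsRegularProfile S P) (hS : IsSepSystem S) :
    IsRegularOrientation S P :=
  ((isRegularProfile_iff hS).1 hP).1

/-- Otherwise `inv r ∈ P`, and the profile property for `inv r` and `s` excludes `r ⊓ inv s`. -/
lemma IsRegularProfile.mem_of_inf_inv_mem (hP : IsRegularProfile S P) (hr : r ∈ S)
    (hs : s ∈ P) (h : r ⊓ inv s ∈ P) : r ∈ P := by
  by_contra hr'
  have := hP.profile _ ((hP.orientation.total r hr).resolve_left hr') s hs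
  rw [inv_inv] at this
  exact this h

end Orientations

section Shifting

variable {U : Type*} [SepUniverse U] {S σ : Set U} {p s : U}

lemma IsStar.insert (hσ : IsStar σ) (h : ∀ t ∈ σ, s ≤ inv t) : IsStar (insert s σ) := by
  rintro x (rfl | hx) y (rfl | hy) hxy
  · exact (hxy rfl).elim
  · exact h y hy
  · exact le_inv_comm.1 (h x hx)
  · exact hσ x hx y hy hxy

lemma isStar_singleton (s : U) : IsStar {s} := by
  rintro x rfl y rfl hxy
  exact (hxy rfl).elim

/-- The star obtained from the star `σ` by shifting its element `p` to `p ⊔ s`: all the other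
elements are reduced so that they still point towards it. -/
def shift (σ : Set U) (p s : U) : Set U := insert (p ⊔ s) ((· ⊓ inv s) '' (σ \ {p}))

lemma sup_mem_shift : p ⊔ s ∈ shift σ p s := Set.mem_insert _ _

lemma inf_inv_mem_shift {z : U} (hz : z ∈ σ) (hzp : z ≠ p) : z ⊓ inv s ∈ shift σ p s :=
  .inr ⟨z, ⟨hz, hzp⟩, rfl⟩

lemma ncard_shift_le (hσ : σ.Finite) (hp : p ∈ σ) : (shift σ p s).ncard ≤ σ.ncard :=
  calc (shift σ p s).ncard
    _ ≤ ((· ⊓ inv s) '' (σ \ {p})).ncard + 1 := Set.ncard_insert_le _ _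
    _ ≤ (σ \ {p}).ncard + 1 := Nat.add_le_add_right (Set.ncard_image_le hσ.sdiff) 1
    _ = σ.ncard := Set.ncard_sdiff_singleton_add_one hp hσ

lemma IsStar.shift (hσ : IsStar σ) (hp : p ∈ σ) : IsStar (shift σ p s) := by
  refine IsStar.insert ?_ ?_
  · rintro _ ⟨x, hx, rfl⟩ _ ⟨y, hy, rfl⟩ hxy
    have hxy' : x ≤ inv y := hσ x hx.1 y hy.1 fun h => hxy (h ▸ rfl)
    exact inf_le_left.trans (hxy'.trans (inv_le_inv inf_le_left))
  · rintro _ ⟨x, ⟨hx, hxp⟩, rfl⟩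
    simpa only [inv_inf, inv_inv] using sup_le_sup_right (hσ p hp x hx (Ne.symm hxp)) s

lemma IsStar.shift_subset (hσ : IsStar σ) (hS : IsSepSystem S) (hσS : σ ⊆ S) (hp : p ∈ σ)
    (h : IsJoinLinked S p s) : AbstractSep.shift σ p s ⊆ S := by
  rintro _ (rfl | ⟨x, ⟨hx, hxp⟩, rfl⟩)
  · exact h p (hσS hp) le_rfl
  · exact h.inf_inv_mem hS (hσS hx) (hσ p hp x hx (Ne.symm hxp))

/-- A family of stars in `S` that contains all cosmall singletons and is closed under the shifts
that stay inside `S`. -/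
structure IsShiftable (S : Set U) (F : Set (Set U)) : Prop where
  isStar : ∀ {σ}, σ ∈ F → IsStar σ
  subset : ∀ {σ}, σ ∈ F → σ ⊆ S
  singleton_mem : ∀ {s}, s ∈ S → IsCosmall s → {s} ∈ F
  shift_mem : ∀ {σ p s}, σ ∈ F → p ∈ σ → s ∈ S → IsJoinLinked S p s → shift σ p s ∈ F

end Shifting

section Forcing

variable {U : Type*} [SepUniverse U] {S A B σ : Set U} {F : Set (Set U)} {p r s x : U}

/-- `x` can be derived from `A` by the rule that an orientation which contains no star of `F` and
all but one element of a star in `F` must contain the inverse of the remaining element. A derivation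
amounts to an `S`-tree over `F`, except for leaves labelled by `A` and an outer edge labelled
by `x`. -/
inductive Forced (F : Set (Set U)) (A : Set U) : U → Prop
  | of_mem {x : U} : x ∈ A → Forced F A x
  | of_star {x : U} {σ : Set U} : σ ∈ F → inv x ∈ σ → (∀ y ∈ σ, y ≠ inv x → Forced F A y) →
      Forced F A x

/-- No orientation that contains `A` avoids `F`, as both orientations of some separation are
forced. -/
def IsContradictory (F : Set (Set U)) (A : Set U) : Prop :=
  ∃ x, Forced F A x ∧ Forced F A (inv x)

lemma Forced.trans (hx : Forced F A x) (hA : ∀ y ∈ A, Forced F B y) : Forced F B x := by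
  induction hx with
  | of_mem h => exact hA _ h
  | of_star hσ hx _ ih => exact .of_star hσ hx ih

lemma IsContradictory.trans (h : IsContradictory F A) (hA : ∀ y ∈ A, Forced F B y) :
    IsContradictory F B :=
  let ⟨x, hx, hx'⟩ := h
  ⟨x, hx.trans hA, hx'.trans hA⟩

lemma Forced.inv_of_singleton_mem (h : {s} ∈ F) : Forced F A (inv s) :=
  .of_star h (by simp) fun _ hy hne => (hne (by simpa using hy)).elim

lemma IsShiftable.forced_of_isSmall (hF : IsShiftable S F) (hS : IsSepSystem S) (hs : s ∈ S)
    (h : IsSmall s) : Forced F A s := by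
  have hcosmall : IsCosmall (inv s) := isCosmall_iff.2 (by rwa [inv_inv])
  simpa only [inv_inv] using Forced.inv_of_singleton_mem
    (hF.singleton_mem (hS.inv_mem s hs) hcosmall)

lemma IsShiftable.isContradictory_of_inv_eq (hF : IsShiftable S F) (hS : IsSepSystem S)
    (hs : s ∈ S) (h : inv s = s) : IsContradictory F A :=
  have hforced : Forced F A s := hF.forced_of_isSmall hS hs h.ge
  ⟨s, hforced, h.symm ▸ hforced⟩

lemma IsShiftable.forced_inv_sup (hF : IsShiftable S F) (hσ : σ ∈ F) (hp : p ∈ σ) (hs : s ∈ S)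
    (hps : IsJoinLinked S p s) (h : ∀ z ∈ σ, z ≠ p → Forced F A (z ⊓ inv s)) :
    Forced F A (inv (p ⊔ s)) := by
  refine .of_star (hF.shift_mem hσ hp hs hps) (by rw [inv_inv]; exact sup_mem_shift) ?_
  rintro _ (rfl | ⟨z, ⟨hz, hzp⟩, rfl⟩) hne
  · exact (hne (inv_inv _).symm).elim
  · exact h z hz hzp

lemma Forced.inf_inv (hx : Forced F A x) (hF : IsShiftable S F) (hS : IsSepSystem S)
    (hA : IsDownClosedIn S A) (hs : s ∈ S) (hxs : IsJoinLinked S (inv x) s) :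
    Forced F A (x ⊓ inv s) := by
  induction hx with
  | @of_mem x h =>
    have hmem := hxs.inf_inv_mem hS (hA.subset h) le_rfl
    exact .of_mem (hA.mem_of_le hmem h inf_le_left)
  | @of_star x σ hσ hx _ ih =>
    have hforced := hF.forced_inv_sup hσ hx hs hxs fun z hz hzx => ih z hz hzx
      (hxs.mono_left (hF.isStar hσ _ hx z hz (Ne.symm hzx)))
    rwa [inv_sup, inv_inv] at hforced

/-- In a derivation that uses `r`, every element on the path from a leaf `r` to the outer edge lies
above `r`. Shifting this path by `s` turns the derivation of `x` from `r` into one of `inv s` from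
`inv (x ⊔ s)`. -/
lemma Forced.of_insert (hx : Forced F (insert r A) x) (hF : IsShiftable S F) (hS : IsSepSystem S)
    (hA : IsDownClosedIn S A) (hs : s ∈ S) (hlink : IsJoinLinked S r s) (hrs : r ≤ s)
    (hr : ¬ IsSmall r) :
    Forced F A x ∨ (r ≤ x ∧ (Forced F A (inv (x ⊔ s)) → Forced F A (inv s))) := by
  induction hx with
  | @of_mem x h =>
    rcases h with rfl | h
    · exact .inr ⟨le_rfl, fun h => by rwa [sup_eq_right.2 hrs] at h⟩
    · exact .inl (.of_mem h)
  | @of_star x σ hσ hx _ ih =>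
    by_cases hall : ∀ y ∈ σ, y ≠ inv x → Forced F A y
    · exact .inl (.of_star hσ hx hall)
    push Not at hall
    obtain ⟨y, hy, hyx, hy_not⟩ := hall
    obtain ⟨hry, hy_inv⟩ := (ih y hy hyx).resolve_left hy_not
    have hyx_le : y ≤ x := by simpa only [inv_inv] using hF.isStar hσ y hy _ hx hyx
    refine .inr ⟨hry.trans hyx_le, fun hxs => hy_inv ?_⟩
    refine hF.forced_inv_sup hσ hy hs (hlink.mono_left hry) fun z hz hzy => ?_
    rcases eq_or_ne z (inv x) with rfl | hzx
    · rwa [← inv_sup]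
    have hrz : r ≤ inv z := hry.trans (hF.isStar hσ y hy z hz (Ne.symm hzy))
    have hz_forced : Forced F A z := (ih z hz hzx).resolve_right fun h =>
      hr (hrz.trans (inv_le_inv h.1))
    exact hz_forced.inf_inv hF hS hA hs (hlink.mono_left hrz)

lemma IsContradictory.of_insert (h : IsContradictory F (insert r A)) (hF : IsShiftable S F)
    (hS : IsSepSystem S) (hA : IsDownClosedIn S A) (hr : r ∈ S) (hs : s ∈ S)
    (hlink : IsJoinLinked S r s) (hrs : r ≤ s) : IsContradictory F A ∨ Forced F A (inv s) := by
  by_cases hsmall : IsSmall r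
  · refine .inl (h.trans ?_)
    rintro y (rfl | hy)
    · exact hF.forced_of_isSmall hS hr hsmall
    · exact .of_mem hy
  have forced_inv : ∀ x, Forced F A (inv x) →
      (r ≤ x ∧ (Forced F A (inv (x ⊔ s)) → Forced F A (inv s))) → Forced F A (inv s) := by
    intro x hx ⟨hrx, himp⟩
    refine himp (inv_sup x s ▸ hx.inf_inv hF hS hA hs ?_)
    exact (inv_inv x).symm ▸ hlink.mono_left hrx
  obtain ⟨x, hx, hx'⟩ := h
  rcases hx.of_insert hF hS hA hs hlink hrs hsmall with hx | hx <;>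
    rcases hx'.of_insert hF hS hA hs hlink hrs hsmall with hx' | hx'
  · exact .inl ⟨x, hx, hx'⟩
  · exact .inr (forced_inv (inv x) (by rwa [inv_inv]) hx')
  · exact .inr (forced_inv x hx' hx)
  · exact (hsmall (hx.1.trans (le_inv_comm.1 hx'.1))).elim

end Forcing

section Duality

variable {U : Type*} [SepUniverse U] {S A O : Set U} {F : Set (Set U)}

/-- An `F`-tangle of `S`: a regular and consistent orientation of `S` that contains no star
of `F`. -/
structure IsTangle (S : Set U) (F : Set (Set U)) (O : Set U) : Prop
    extends IsRegularOrientation S O where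
  not_subset : ∀ {σ}, σ ∈ F → ¬ σ ⊆ O

lemma IsRegularOrientation.isTangle_or_isContradictory (hO : IsRegularOrientation S O)
    (hempty : ∅ ∉ F) : IsTangle S F O ∨ IsContradictory F O := by
  by_cases h : ∃ σ ∈ F, σ ⊆ O
  · obtain ⟨σ, hσ, hσO⟩ := h
    obtain ⟨x, hx⟩ := Set.nonempty_iff_ne_empty.2 fun h => hempty (h ▸ hσ)
    exact .inr ⟨x, .of_mem (hσO hx), .of_star hσ (by rwa [inv_inv]) fun y hy _ => .of_mem (hσO hy)⟩
  · push Not at h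
    exact .inl ⟨hO, fun hσ => h _ hσ⟩

/-- If two undecided separations `r` and `q` with `r ≤ inv q` are linked by `s`, then contradictory
extensions of `A` by `r` and by `q` combine to a derivation of `inv s` and `s` from `A`. -/
theorem IsPartialOrientation.exists_isTangle_or_isContradictory (hA : IsPartialOrientation S A)
    (hS : IsSepSystem S) (hsub : IsStructurallySubmodular S) (hF : IsShiftable S F)
    (hempty : ∅ ∉ F) : (∃ O, A ⊆ O ∧ IsTangle S F O) ∨ IsContradictory F A := by
  induction hn : (S \ A).ncard using Nat.strong_induction_on generalizing A with
  | _ n ih =>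
  subst hn
  by_cases htot : ∀ s ∈ S, s ∈ A ∨ inv s ∈ A
  · have hO : IsRegularOrientation S A := ⟨hA, fun hs => htot _ hs⟩
    exact (hO.isTangle_or_isContradictory hempty).imp_left
      fun h => ⟨A, Set.Subset.rfl, h⟩
  by_contra! hnone
  obtain ⟨hno_tangle, hno_contra⟩ := hnone
  have insert_contradictory : ∀ r ∈ S, ¬ (r ∈ A ∨ inv r ∈ A) →
      (∀ t ∈ S, t < r → t ∈ A ∨ inv t ∈ A) → IsContradictory F (insert r A) := by
    intro r hr hundecided hlt
    rw [not_or] at hundecided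
    have hne : inv r ≠ r := fun h => hno_contra (hF.isContradictory_of_inv_eq hS hr h)
    have hssub : S \ insert r A ⊂ S \ A :=
      ⟨Set.sdiff_subset_sdiff_right (Set.subset_insert r A),
        fun h => (h ⟨hr, hundecided.1⟩).2 (Set.mem_insert r A)⟩
    refine (ih _ (Set.ncard_lt_ncard hssub hS.finite.sdiff)
      (hA.insert_of_minimal hS hr hne hundecided.2 hlt) rfl).resolve_left ?_
    rintro ⟨O, hAO, hO⟩
    exact hno_tangle O ((Set.subset_insert r A).trans hAO) hO
  push Not at htot
  obtain ⟨u, hu, hu_undecided⟩ := htot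
  obtain ⟨r, hr, -, hr_undecided, hr_min⟩ := exists_minimal_undecided hS.finite
    (fun t => t ∈ A ∨ inv t ∈ A) hu (not_or.2 hu_undecided)
  obtain ⟨q, hq, hqr, hq_undecided, hq_min⟩ := exists_minimal_undecided hS.finite
    (fun t => t ∈ A ∨ inv t ∈ A) (hS.inv_mem r hr) (by rwa [inv_inv, or_comm])
  obtain ⟨s, hs, hrs, hqs, hlink, hlink'⟩ :=
    hsub.exists_isJoinLinked hS hr hq (le_inv_comm.1 hqr)
  have hforced : Forced F A (inv s) := ((insert_contradictory r hr hr_undecided hr_min).of_insert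
    hF hS hA.toIsDownClosedIn hr hs hlink hrs).resolve_left hno_contra
  have hforced' : Forced F A (inv (inv s)) := ((insert_contradictory q hq hq_undecided
    hq_min).of_insert hF hS hA.toIsDownClosedIn hq (hS.inv_mem s hs) hlink' hqs).resolve_left
      hno_contra
  exact hno_contra ⟨inv s, hforced, hforced'⟩

lemma isPartialOrientation_empty : IsPartialOrientation S ∅ where
  subset := Set.empty_subset S
  mem_of_le := fun _ h => h.elim
  inv_notMem := fun h => h.elim

/-- The derivation of `x` ends with a star that contains `inv x`, and all of the other elements of
this star are forced. -/
lemma IsContradictory.exists_forall_forced (h : IsContradictory F (∅ : Set U)) :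
    ∃ σ ∈ F, ∀ x ∈ σ, Forced F ∅ x := by
  obtain ⟨x, hx | @⟨_, σ, hσ, hxσ, hforced⟩, hx'⟩ := h
  · contradiction
  · refine ⟨σ, hσ, fun y hy => ?_⟩
    rcases eq_or_ne y (inv x) with rfl | hyx
    · exact hx'
    · exact hforced y hy hyx

theorem exists_forall_forced (hS : IsSepSystem S) (hsub : IsStructurallySubmodular S)
    (hF : IsShiftable S F) (hno : ∀ O, ¬ IsTangle S F O) : ∃ σ ∈ F, ∀ x ∈ σ, Forced F ∅ x := by
  by_cases hempty : ∅ ∈ F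
  · exact ⟨∅, hempty, fun x hx => hx.elim⟩
  · refine ((isPartialOrientation_empty.exists_isTangle_or_isContradictory hS hsub hF
      hempty).resolve_left ?_).exists_forall_forced
    rintro ⟨O, -, hO⟩
    exact hno O hO

end Duality

/-- A rooted tree on `V` given by parent pointers, used to assemble `S`-trees from derivations. The
label of a vertex `v` is the label of its edge towards the root, and the label of the root that of
an outer edge which is not part of the tree. The parent of the root is a junk value. -/
structure RootedTree (V U : Type*) where
  /-- the root -/
  root : V
  /-- the next vertex on the path to the root -/
  parent : V → V
  /-- a height function, which excludes cycles -/
  depth : V → ℕ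
  depth_parent_lt : ∀ v, v ≠ root → depth (parent v) < depth v
  /-- the label of the edge from a vertex to its parent, directed towards the parent -/
  label : V → U

namespace RootedTree

section Graph

variable {V U : Type*} (R : RootedTree V U) {u v : V}

/-- The set of the children of `v`. -/
def children (v : V) : Set V := {u | u ≠ R.root ∧ R.parent u = v}

variable {R} in
lemma depth_lt_of_mem_children (h : u ∈ R.children v) : R.depth v < R.depth u :=
  h.2 ▸ R.depth_parent_lt u h.1

variable {R} in
lemma notMem_children_of_mem_children (h : u ∈ R.children v) : v ∉ R.children u :=
  fun h' => (depth_lt_of_mem_children h).asymm (depth_lt_of_mem_children h')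

/-- The graph in which every vertex is adjacent to its children. -/
def graph : SimpleGraph V where
  Adj u v := u ∈ R.children v ∨ v ∈ R.children u
  symm := ⟨fun _ _ => Or.symm⟩
  loopless := ⟨fun _ h => h.elim (fun h => notMem_children_of_mem_children h h)
    fun h => notMem_children_of_mem_children h h⟩

lemma reachable_root (v : V) : R.graph.Reachable v R.root := by
  induction hn : R.depth v using Nat.strong_induction_on generalizing v with
  | _ n ih =>
  rcases eq_or_ne v R.root with rfl | hv
  · rfl
  · have hadj : R.graph.Adj v (R.parent v) := .inl ⟨hv, rfl⟩
    exact hadj.reachable.trans (ih _ (hn ▸ R.depth_parent_lt v hv) _ rfl)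

lemma connected_graph : R.graph.Connected where
  preconnected u v := (R.reachable_root u).trans (R.reachable_root v).symm
  nonempty := ⟨R.root⟩

lemma card_edgeSet_lt [Finite V] : Nat.card R.graph.edgeSet < Nat.card V := by
  have hsub : R.graph.edgeSet ⊆ (fun v => s(v, R.parent v)) '' {R.root}ᶜ := by
    intro e
    induction e with
    | _ u v =>
    rintro (h | h)
    · exact ⟨u, h.1, congrArg (s(u, ·)) h.2⟩
    · exact ⟨v, h.1, (congrArg (s(v, ·)) h.2).trans Sym2.eq_swap⟩
  calc Nat.card R.graph.edgeSet
    _ ≤ ((fun v => s(v, R.parent v)) '' {R.root}ᶜ).ncard := Set.ncard_le_ncard hsub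
    _ ≤ ({R.root}ᶜ : Set V).ncard := Set.ncard_image_le
    _ < ({R.root}ᶜ : Set V).ncard + 1 := Nat.lt_succ_self _
    _ = Nat.card V := by
      rw [← Set.ncard_add_ncard_compl {R.root}, Set.ncard_singleton, Nat.add_comm]

lemma isTree_graph [Finite V] : R.graph.IsTree :=
  SimpleGraph.isTree_iff_connected_and_card.2 ⟨R.connected_graph,
    le_antisymm R.card_edgeSet_lt R.connected_graph.card_vert_le_card_edgeSet_add_one⟩

end Graph

section Glue

variable {ι U : Type*} {V : ι → Type*}

open Classical in
/-- The rooted tree obtained from the trees `R i` by joining their roots to a new root with outer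
label `x`. -/
noncomputable def glue (x : U) (R : ∀ i, RootedTree (V i) U) :
    RootedTree (Option (Σ i, V i)) U where
  root := none
  parent
    | none => none
    | some ⟨i, v⟩ => if v = (R i).root then none else some ⟨i, (R i).parent v⟩
  depth
    | none => 0
    | some ⟨i, v⟩ => (R i).depth v + 1
  depth_parent_lt
    | none, h => (h rfl).elim
    | some ⟨i, v⟩, _ => by
      by_cases hv : v = (R i).root
      · simp [hv]
      · simpa [hv] using (R i).depth_parent_lt v hv
  label
    | none => x
    | some ⟨i, v⟩ => (R i).label v

variable (x : U) (R : ∀ i, RootedTree (V i) U)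

lemma none_notMem_children_glue {w : Option (Σ i, V i)} : none ∉ (glue x R).children w :=
  fun h => h.1 rfl

lemma some_mem_children_glue {i : ι} {u : V i} {w : Option (Σ i, V i)} :
    some ⟨i, u⟩ ∈ (glue x R).children w ↔
      u = (R i).root ∧ w = none ∨ u ≠ (R i).root ∧ w = some ⟨i, (R i).parent u⟩ := by
  by_cases hu : u = (R i).root <;> simp [children, glue, hu, eq_comm]

lemma children_glue_none :
    (glue x R).children none = Set.range fun i => some ⟨i, (R i).root⟩ := by
  ext (_ | ⟨i, u⟩)
  · simpa using none_notMem_children_glue x R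
  · rw [some_mem_children_glue]
    grind

lemma children_glue_some (i : ι) (v : V i) :
    (glue x R).children (some ⟨i, v⟩) = (fun u => some ⟨i, u⟩) '' (R i).children v := by
  ext (_ | ⟨j, u⟩)
  · simpa using none_notMem_children_glue x R
  · rw [some_mem_children_glue]
    grind [children]

lemma image_label_children_glue :
    (glue x R).label '' (glue x R).children none = Set.range fun i => (R i).label (R i).root := by
  rw [children_glue_none, ← Set.range_comp]
  rfl

variable {R} in
lemma injOn_label_children_glue (h : Function.Injective fun i => (R i).label (R i).root) :
    Set.InjOn (glue x R).label ((glue x R).children none) := by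
  rw [children_glue_none, ← Set.image_univ]
  exact Set.InjOn.image_of_comp h.injOn

end Glue

section Labels

variable {V U : Type*} [SepUniverse U] {F : Set (Set U)}

/-- The labels of the edges from the children of `v` are distinct, distinct from the label of the
edge from the parent, and together they form a star in `F`. -/
structure IsOverAt (R : RootedTree V U) (F : Set (Set U)) (v : V) : Prop where
  injOn : Set.InjOn R.label (R.children v)
  inv_notMem : inv (R.label v) ∉ R.label '' R.children v
  insert_mem : insert (inv (R.label v)) (R.label '' R.children v) ∈ F

lemma IsOverAt.glue {ι : Type*} {W : ι → Type*} {R : ∀ i, RootedTree (W i) U} {i : ι} {v : W i}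
    (h : (R i).IsOverAt F v) (x : U) : (glue x R).IsOverAt F (some ⟨i, v⟩) := by
  have himage : (RootedTree.glue x R).label '' (RootedTree.glue x R).children (some ⟨i, v⟩) =
      (R i).label '' (R i).children v := by
    rw [children_glue_some, Set.image_image]
    rfl
  refine ⟨?_, himage ▸ h.inv_notMem, himage ▸ h.insert_mem⟩
  rw [children_glue_some]
  exact Set.InjOn.image_of_comp h.injOn

/-- The trees are indexed by `Fin n` rather than by `τ` to keep the vertex type in `Type`. -/
lemma exists_bijOn_label_children_root {τ : Set U} (hτ : τ.Finite) (x : U)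
    (h : ∀ y ∈ τ, ∃ (V : Type) (_ : Fintype V) (R : RootedTree V U),
      R.label R.root = y ∧ ∀ v, R.IsOverAt F v) :
    ∃ (V : Type) (_ : Fintype V) (R : RootedTree V U), R.label R.root = x ∧
      Set.BijOn R.label (R.children R.root) τ ∧ ∀ v ≠ R.root, R.IsOverAt F v := by
  obtain ⟨n, ⟨e⟩⟩ := @Finite.exists_equiv_fin τ hτ
  choose V hV R hroot hR using fun i : Fin n => h (e.symm i) (e.symm i).2
  have hrange : (Set.range fun i => (R i).label (R i).root) = τ := by
    simp only [hroot]
    exact (e.symm.surjective.range_comp Subtype.val).trans Subtype.range_coe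
  have hinj : Function.Injective fun i => (R i).label (R i).root := by
    simp only [hroot]
    exact Subtype.val_injective.comp e.symm.injective
  refine ⟨_, inferInstance, glue x R, rfl, ?_, ?_⟩
  · rw [← hrange, ← image_label_children_glue x R]
    exact (injOn_label_children_glue x hinj).bijOn_image
  · rintro (_ | ⟨i, v⟩) hv
    · exact (hv rfl).elim
    · exact (hR i v).glue x

end Labels

end RootedTree

section Assembly

variable {U : Type*} [SepUniverse U] {S : Set U} {F : Set (Set U)}

lemma Forced.exists_rootedTree {x : U} (h : Forced F ∅ x) (hF : ∀ σ ∈ F, σ.Finite) :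
    ∃ (V : Type) (_ : Fintype V) (R : RootedTree V U),
      R.label R.root = x ∧ ∀ v, R.IsOverAt F v := by
  induction h with
  | of_mem h => exact h.elim
  | @of_star x σ hσ hx _ ih =>
    obtain ⟨V, _, R, hroot, hbij, hR⟩ := RootedTree.exists_bijOn_label_children_root
      ((hF σ hσ).sdiff (t := {inv x})) x fun y hy => ih y hy.1 hy.2
    refine ⟨V, inferInstance, R, hroot, fun v => ?_⟩
    rcases eq_or_ne v R.root with rfl | hv
    · refine ⟨hbij.injOn, ?_, ?_⟩
      · rw [hbij.image_eq, hroot]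
        exact fun h => h.2 rfl
      · rwa [hbij.image_eq, hroot, Set.insert_sdiff_singleton, Set.insert_eq_of_mem hx]
    · exact hR v hv

namespace RootedTree

variable {V : Type*} (R : RootedTree V U)

open Classical in
/-- The label of the pair `(u, v)`, which is only meaningful if one of `u` and `v` is a child of the
other one. -/
noncomputable def pairLabel (u v : V) : U :=
  if u ∈ R.children v then R.label u else inv (R.label v)

variable {R} {u v : V}

lemma pairLabel_of_mem_children (h : u ∈ R.children v) : R.pairLabel u v = R.label u :=
  if_pos h

lemma pairLabel_of_mem_children_swap (h : v ∈ R.children u) : R.pairLabel u v = inv (R.label v) :=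
  if_neg (notMem_children_of_mem_children h)

variable (R)

/-- The `S`-tree obtained from a rooted tree by forgetting the root and the outer edge. -/
noncomputable def toSTree [Finite V] (hS : IsSepSystem S)
    (hR : ∀ v ≠ R.root, R.label v ∈ S) : STree S V where
  graph := R.graph
  isTree := R.isTree_graph
  label e := R.pairLabel e.fst e.snd
  label_mem e := by
    rcases e.adj with h | h
    · rw [pairLabel_of_mem_children h]
      exact hR _ h.1
    · rw [pairLabel_of_mem_children_swap h]
      exact hS.inv_mem _ (hR _ h.1)
  label_symm e := by
    rcases e.adj with h | h
    · rw [pairLabel_of_mem_children h]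
      exact pairLabel_of_mem_children_swap h
    · rw [pairLabel_of_mem_children_swap h, inv_inv]
      exact pairLabel_of_mem_children h

variable [Finite V] (hS : IsSepSystem S) (hR : ∀ v ≠ R.root, R.label v ∈ S)

lemma labelsAt_toSTree_root :
    (R.toSTree hS hR).labelsAt R.root = R.label '' R.children R.root := by
  ext s
  constructor
  · rintro ⟨⟨⟨u, _⟩, h | h⟩, rfl, rfl⟩
    · exact ⟨u, h, (pairLabel_of_mem_children h).symm⟩
    · exact (h.1 rfl).elim
  · rintro ⟨u, hu, rfl⟩
    exact ⟨⟨(u, R.root), .inl hu⟩, rfl, pairLabel_of_mem_children hu⟩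

lemma labelsAt_toSTree_of_ne_root (hv : v ≠ R.root) :
    (R.toSTree hS hR).labelsAt v = insert (inv (R.label v)) (R.label '' R.children v) := by
  ext s
  constructor
  · rintro ⟨⟨⟨u, _⟩, h | h⟩, rfl, rfl⟩
    · exact .inr ⟨u, h, (pairLabel_of_mem_children h).symm⟩
    · exact .inl (pairLabel_of_mem_children_swap h)
  · rintro (rfl | ⟨u, hu, rfl⟩)
    · have hmem : v ∈ R.children (R.parent v) := ⟨hv, rfl⟩
      exact ⟨⟨(R.parent v, v), .inr hmem⟩, rfl, pairLabel_of_mem_children_swap hmem⟩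
    · exact ⟨⟨(u, v), .inl hu⟩, rfl, pairLabel_of_mem_children hu⟩

lemma isIrredundant_toSTree (hinj : ∀ v, Set.InjOn R.label (R.children v))
    (hinv : ∀ v ≠ R.root, inv (R.label v) ∉ R.label '' R.children v) :
    (R.toSTree hS hR).IsIrredundant := by
  rintro ⟨⟨u, v⟩, huv⟩ ⟨⟨w, _⟩, hwv⟩ rfl hne heq
  change R.pairLabel u v = R.pairLabel w v at heq
  rcases huv with hu | hu <;> rcases hwv with hw | hw
  · rw [pairLabel_of_mem_children hu, pairLabel_of_mem_children hw] at heq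
    exact hne (hinj v hu hw heq)
  · rw [pairLabel_of_mem_children hu, pairLabel_of_mem_children_swap hw] at heq
    exact hinv v hw.1 ⟨u, hu, heq⟩
  · rw [pairLabel_of_mem_children_swap hu, pairLabel_of_mem_children hw] at heq
    exact hinv v hu.1 ⟨w, hw, heq.symm⟩
  · exact hne (hu.2.symm.trans hw.2)

end RootedTree

/-- The `S`-tree whose only vertex is isolated. -/
def STree.single (S : Set U) : STree S Unit where
  graph := ⊥
  isTree := .of_subsingleton
  label e := e.adj.elim
  label_mem e := e.adj.elim
  label_symm e := e.adj.elim

/-- The `S`-tree `T` is over `F`: the labels of the edges at every vertex form an element of `F`. -/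
def STree.IsOver {V : Type*} (T : STree S V) (F : Set (Set U)) : Prop := ∀ t, T.labelsAt t ∈ F

lemma exists_isOver_of_forall_forced (hS : IsSepSystem S) (hF : ∀ σ ∈ F, σ ⊆ S) {σ : Set U}
    (hσ : σ ∈ F) (hforced : ∀ x ∈ σ, Forced F ∅ x) :
    ∃ (V : Type) (_ : Fintype V) (T : STree S V), T.IsIrredundant ∧ T.IsOver F := by
  have hfin : ∀ σ ∈ F, σ.Finite := fun σ hσ => hS.finite.subset (hF σ hσ)
  rcases σ.eq_empty_or_nonempty with rfl | ⟨x, -⟩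
  · refine ⟨Unit, inferInstance, .single S, fun e => e.adj.elim, fun t => ?_⟩
    have hlabels : (STree.single S).labelsAt t = ∅ :=
      Set.eq_empty_of_forall_notMem fun s ⟨e, _⟩ => e.adj.elim
    rwa [hlabels]
  obtain ⟨V, _, R, -, hbij, hR⟩ := RootedTree.exists_bijOn_label_children_root (hfin σ hσ) x
    fun y hy => (hforced y hy).exists_rootedTree hfin
  have hRS : ∀ v ≠ R.root, R.label v ∈ S := fun v hv =>
    hS.inv_mem_iff.1 (hF _ (hR v hv).insert_mem (Set.mem_insert _ _))
  refine ⟨V, inferInstance, R.toSTree hS hRS, R.isIrredundant_toSTree hS hRS (fun v => ?_)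
    fun v hv => (hR v hv).inv_notMem, fun v => ?_⟩ <;> rcases eq_or_ne v R.root with rfl | hv
  · exact hbij.injOn
  · exact (hR v hv).injOn
  · rwa [R.labelsAt_toSTree_root, hbij.image_eq]
  · rw [R.labelsAt_toSTree_of_ne_root hS hRS hv]
    exact (hR v hv).insert_mem

theorem IsShiftable.exists_isOver_of_forall_not_isTangle (hF : IsShiftable S F) (hS : IsSepSystem S)
    (hsub : IsStructurallySubmodular S) (hno : ∀ O, ¬ IsTangle S F O) :
    ∃ (V : Type) (_ : Fintype V) (T : STree S V), T.IsIrredundant ∧ T.IsOver F :=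
  let ⟨_, hσ, hforced⟩ := exists_forall_forced hS hsub hF hno
  exists_isOver_of_forall_forced hS (fun _ => hF.subset) hσ hforced

end Assembly

section DeterminingSets

variable {U : Type*} [SepUniverse U] {S P D D' : Set U} {r s : U}

/-- `D` is a subset of `P` that is contained in no other regular profile of `S`. For a regular
profile `P`, these are the sets of separations distinguishing `P` from all other regular profiles,
up to the choice of the orientations of their elements. -/
structure IsDetermining (S P D : Set U) : Prop where
  subset : D ⊆ P
  eq_of_subset : ∀ {Q}, IsRegularProfile S Q → D ⊆ Q → Q = P

lemma IsDetermining.of_subset_imp (hD : IsDetermining S P D) (hD'P : D' ⊆ P)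
    (h : ∀ {Q}, IsRegularProfile S Q → D' ⊆ Q → D ⊆ Q) : IsDetermining S P D' :=
  ⟨hD'P, fun hQ hD'Q => hD.eq_of_subset hQ (h hQ hD'Q)⟩

lemma IsDetermining.distinguishesFromOthers (hD : IsDetermining S P D) (hPS : P ⊆ S) :
    DistinguishesFromOthers S P D := by
  refine ⟨hD.subset.trans hPS, fun Q hQ hne => ?_⟩
  obtain ⟨s, hs, hsQ⟩ := Set.not_subset.1 fun h => hne (hD.eq_of_subset hQ h)
  have hsP := hD.subset hs
  exact ⟨s, hs, .inl ⟨hsP, (hQ.orientation.total s (hPS hsP)).resolve_left hsQ⟩⟩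

lemma IsRegularProfile.isDetermining_self (hP : IsRegularProfile S P) (hS : IsSepSystem S) :
    IsDetermining S P P :=
  ⟨Set.Subset.rfl, fun hQ h =>
    ((hP.isRegularOrientation hS).eq_of_subset (hQ.isRegularOrientation hS) h).symm⟩

open Classical in
lemma DistinguishesFromOthers.isDetermining_image (hD : DistinguishesFromOthers S P D)
    (hP : IsRegularProfile S P) (hS : IsSepSystem S) :
    IsDetermining S P ((fun s => if s ∈ P then s else inv s) '' D) where
  subset := by
    rintro _ ⟨s, hs, rfl⟩
    dsimp only
    split_ifs with h
    · exact h
    · exact (hP.orientation.total s (hD.1 hs)).resolve_left h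
  eq_of_subset {Q} hQ hDQ := by
    by_contra hne
    obtain ⟨s, hs, hdist⟩ := hD.2 Q hQ hne
    have hsQ := hDQ (Set.mem_image_of_mem _ hs)
    rcases hdist with ⟨hsP, hsQ'⟩ | ⟨hsP, hsQ'⟩
    · rw [if_pos hsP] at hsQ
      exact (hQ.isRegularOrientation hS).inv_notMem hsQ hsQ'
    · rw [if_neg fun h => (hP.isRegularOrientation hS).inv_notMem h hsP] at hsQ
      exact (hQ.isRegularOrientation hS).inv_notMem hsQ' hsQ

lemma DistinguishesFromOthers.delta_le_ncard (hD : DistinguishesFromOthers S P D)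
    (hfin : D.Finite) : delta S P ≤ D.ncard := by
  lift D to Finset U using hfin
  exact Nat.sInf_le ⟨D, (Set.ncard_coe_finset D).symm, hD⟩

lemma IsDetermining.delta_le_ncard (hD : IsDetermining S P D) (hS : S.Finite) (hPS : P ⊆ S) :
    delta S P ≤ D.ncard :=
  (hD.distinguishesFromOthers hPS).delta_le_ncard (hS.subset (hD.subset.trans hPS))

lemma IsRegularProfile.exists_isDetermining_ncard_le_delta (hP : IsRegularProfile S P)
    (hS : IsSepSystem S) : ∃ D, IsDetermining S P D ∧ D.ncard ≤ delta S P := by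
  have hfin : P.Finite := hS.finite.subset hP.orientation.subset
  have hself := (hP.isDetermining_self hS).distinguishesFromOthers hP.orientation.subset
  obtain ⟨D, hcard, hD⟩ : delta S P ∈ {n : ℕ | ∃ D : Finset U, D.card = n ∧
      DistinguishesFromOthers S P (D : Set U)} := Nat.sInf_mem
        ⟨_, hfin.toFinset, rfl, hfin.coe_toFinset.symm ▸ hself⟩
  refine ⟨_, hD.isDetermining_image hP hS, ?_⟩
  rw [← hcard, ← Set.ncard_coe_finset]
  exact Set.ncard_image_le

lemma IsDetermining.not_le (hD : IsDetermining S P D) (hcard : D.ncard ≤ delta S P)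
    (hS : IsSepSystem S) (hPS : P ⊆ S) (hr : r ∈ D) (hs : s ∈ D) (hne : r ≠ s) : ¬ r ≤ s := by
  intro hrs
  have hsdiff : IsDetermining S P (D \ {r}) :=
    hD.of_subset_imp (Set.sdiff_subset.trans hD.subset) fun {Q} hQ hDQ x hx => by
      rcases eq_or_ne x r with rfl | hxr
      · exact (hQ.isRegularOrientation hS).mem_of_le (hPS (hD.subset hr)) (hDQ ⟨hs, hne.symm⟩) hrs
      · exact hDQ ⟨hx, hxr⟩
  have hlt : (D \ {r}).ncard < D.ncard :=
    Set.ncard_sdiff_singleton_lt_of_mem hr (hS.finite.subset (hD.subset.trans hPS))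
  exact (hlt.trans_le hcard).not_ge (hsdiff.delta_le_ncard hS.finite hPS)

lemma IsDetermining.uncross (hD : IsDetermining S P D) (hP : IsRegularProfile S P)
    (hS : IsSepSystem S) (hr : r ∈ D) (hs : s ∈ D) (hne : r ≠ s) (hmem : r ⊓ inv s ∈ S) :
    IsDetermining S P (insert (r ⊓ inv s) (D \ {r})) := by
  have hPO := hP.isRegularOrientation hS
  refine hD.of_subset_imp (Set.insert_subset (hPO.mem_of_le hmem (hD.subset hr) inf_le_left)
    (Set.sdiff_subset.trans hD.subset)) fun hQ hDQ x hx => ?_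
  rcases eq_or_ne x r with rfl | hxr
  · exact hQ.mem_of_inf_inv_mem (hPO.subset (hD.subset hr)) (hDQ (.inr ⟨hs, hne.symm⟩))
      (hDQ (Set.mem_insert _ _))
  · exact hDQ (.inr ⟨hx, hxr⟩)

lemma IsStructurallySubmodular.inf_inv_mem_or (hsub : IsStructurallySubmodular S)
    (hS : IsSepSystem S) (hr : r ∈ S) (hs : s ∈ S) : r ⊓ inv s ∈ S ∨ s ⊓ inv r ∈ S := by
  refine (hsub r hr (inv s) (hS.inv_mem s hs)).symm.imp_right fun h => ?_
  rwa [← hS.inv_mem_iff, inv_inf, inv_inv, sup_comm]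

/-- Uncrossing two elements of a smallest determining set shrinks its down-closure. -/
theorem IsDetermining.exists_isStar (hD : IsDetermining S P D) (hcard : D.ncard ≤ delta S P)
    (hP : IsRegularProfile S P) (hS : IsSepSystem S) (hsub : IsStructurallySubmodular S) :
    ∃ σ, IsStar σ ∧ IsDetermining S P σ ∧ σ.ncard ≤ delta S P := by
  induction hn : (S ∩ lowerClosure D).ncard using Nat.strong_induction_on generalizing D with
  | _ n ih =>
  subst hn
  have hPS := hP.orientation.subset
  by_cases huncross : ∃ r ∈ D, ∃ s ∈ D, r ≠ s ∧ ¬ r ≤ inv s ∧ r ⊓ inv s ∈ S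
  · obtain ⟨r, hr, s, hs, hne, hrs, hmem⟩ := huncross
    refine ih _ (Set.ncard_lt_ncard ⟨?_, fun h => ?_⟩ (hS.finite.subset Set.inter_subset_left))
      (hD.uncross hP hS hr hs hne hmem) (le_trans ?_ hcard) rfl
    · rintro x ⟨hxS, y, rfl | hy, hxy⟩
      · exact ⟨hxS, r, hr, hxy.trans inf_le_left⟩
      · exact ⟨hxS, y, hy.1, hxy⟩
    · obtain ⟨-, y, rfl | hy, hry⟩ := h ⟨hPS (hD.subset hr), subset_lowerClosure hr⟩
      · exact hrs (hry.trans inf_le_right)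
      · exact hD.not_le hcard hS hPS hr hy.1 (Ne.symm hy.2) hry
    · rw [← Set.ncard_sdiff_singleton_add_one hr (hS.finite.subset (hD.subset.trans hPS))]
      exact Set.ncard_insert_le _ _
  · push Not at huncross
    refine ⟨D, fun r hr s hs hne => ?_, hD, hcard⟩
    by_contra hrs
    rcases hsub.inf_inv_mem_or hS (hPS (hD.subset hr)) (hPS (hD.subset hs)) with h | h
    · exact huncross r hr s hs hne hrs h
    · exact huncross s hs r hr hne.symm (fun h' => hrs (le_inv_comm.1 h')) h

end DeterminingSets

section NodeStars

variable {U : Type*} [SepUniverse U] {S P O σ : Set U} {p r s : U}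

/-- The stars allowed at the nodes of the tree of tangles. They are contained in at most one regular
profile `P`, and then have at most `δ(P)` elements. The bound `ncard_le` is what controls `Δ(T)`. -/
structure IsNodeStar (S σ : Set U) : Prop where
  isStar : IsStar σ
  subset : σ ⊆ S
  ncard_le : σ.ncard ≤ 3 ∨ ∃ P, IsRegularProfile S P ∧ σ.ncard ≤ delta S P
  ncard_le_delta : ∀ {P}, IsRegularProfile S P → σ ⊆ P → σ.ncard ≤ delta S P
  isDetermining : ∀ {P}, IsRegularProfile S P → σ ⊆ P → IsDetermining S P σ

lemma IsNodeStar.of_forall_not_subset (hσ : IsStar σ) (hσS : σ ⊆ S) (hcard : σ.ncard ≤ 3)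
    (h : ∀ P, IsRegularProfile S P → ¬ σ ⊆ P) : IsNodeStar S σ :=
  ⟨hσ, hσS, .inl hcard, fun hP hσP => (h _ hP hσP).elim, fun hP hσP => (h _ hP hσP).elim⟩

lemma isNodeStar_singleton_of_isCosmall (hs : s ∈ S) (h : IsCosmall s) : IsNodeStar S {s} :=
  .of_forall_not_subset (isStar_singleton s) (Set.singleton_subset_iff.2 hs)
    (by rw [Set.ncard_singleton]; norm_num) fun _ hP hsP => hP.regular s (hsP rfl) h

/-- The three sides of the corner `inv r ⊓ inv s`: no profile contains all of them, as it would
contain `r` by `IsRegularProfile.mem_of_inf_inv_mem`. -/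
lemma isNodeStar_triple (hr : r ∈ S) (hs : s ∈ S) (hrs : r ⊓ inv s ∈ S)
    (hcorner : inv r ⊓ inv s ∈ S) : IsNodeStar S {r ⊓ inv s, s, inv r ⊓ inv s} := by
  refine .of_forall_not_subset (((isStar_singleton _).insert ?_).insert ?_) ?_ ?_ fun P hP h => ?_
  · rintro _ rfl
    exact le_inv_comm.1 inf_le_right
  · rintro _ (rfl | rfl)
    · exact inf_le_right
    · rw [inv_inf, inv_inv]
      exact inf_le_left.trans le_sup_left
  · rintro _ (rfl | rfl | rfl) <;> assumption
  · grw [Set.ncard_insert_le, Set.ncard_insert_le, Set.ncard_singleton]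
  · simp only [Set.insert_subset_iff, Set.singleton_subset_iff] at h
    exact hP.profile r (hP.mem_of_inf_inv_mem hr h.2.1 h.1) s h.2.1 h.2.2

lemma IsRegularProfile.exists_isNodeStar (hP : IsRegularProfile S P) (hS : IsSepSystem S)
    (hsub : IsStructurallySubmodular S) : ∃ σ, IsNodeStar S σ ∧ σ ⊆ P := by
  obtain ⟨D, hD, hDcard⟩ := hP.exists_isDetermining_ncard_le_delta hS
  obtain ⟨σ, hstar, hσ, hcard⟩ := hD.exists_isStar hDcard hP hS hsub
  refine ⟨σ, ⟨hstar, hσ.subset.trans hP.orientation.subset, .inr ⟨P, hP, hcard⟩, ?_, ?_⟩,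
    hσ.subset⟩ <;> intro Q hQ hσQ
  · rwa [hσ.eq_of_subset hQ hσQ]
  · rwa [hσ.eq_of_subset hQ hσQ]

lemma IsRegularProfile.subset_of_shift_subset (hP : IsRegularProfile S P) (hS : IsSepSystem S)
    (hσS : σ ⊆ S) (hp : p ∈ σ) (hs : s ∈ S) (h : shift σ p s ⊆ P) : σ ⊆ P := by
  have hPO := hP.isRegularOrientation hS
  have hsup : p ⊔ s ∈ P := h sup_mem_shift
  intro z hz
  rcases eq_or_ne z p with rfl | hzp
  · exact hPO.mem_of_le (hσS hz) hsup le_sup_left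
  · exact hP.mem_of_inf_inv_mem (hσS hz) (hPO.mem_of_le hs hsup le_sup_right)
      (h (inf_inv_mem_shift hz hzp))

lemma IsNodeStar.shift (hσ : IsNodeStar S σ) (hS : IsSepSystem S) (hp : p ∈ σ) (hs : s ∈ S)
    (hps : IsJoinLinked S p s) : IsNodeStar S (shift σ p s) := by
  have hcard := ncard_shift_le (s := s) (hS.finite.subset hσ.subset) hp
  have hsubset {P : Set U} (hP : IsRegularProfile S P) : AbstractSep.shift σ p s ⊆ P → σ ⊆ P :=
    hP.subset_of_shift_subset hS hσ.subset hp hs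
  exact
    { isStar := hσ.isStar.shift hp
      subset := hσ.isStar.shift_subset hS hσ.subset hp hps
      ncard_le := hσ.ncard_le.imp hcard.trans fun ⟨P, hP, h⟩ => ⟨P, hP, hcard.trans h⟩
      ncard_le_delta := fun hP h => hcard.trans (hσ.ncard_le_delta hP (hsubset hP h))
      isDetermining := fun hP h => (hσ.isDetermining hP (hsubset hP h)).of_subset_imp h hsubset }

lemma isShiftable_isNodeStar (hS : IsSepSystem S) : IsShiftable S {σ | IsNodeStar S σ} where
  isStar := IsNodeStar.isStar
  subset := IsNodeStar.subset
  singleton_mem := isNodeStar_singleton_of_isCosmall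
  shift_mem := fun hσ => hσ.shift hS

lemma IsTangle.isRegularProfile (hO : IsTangle S {σ | IsNodeStar S σ} O) (hS : IsSepSystem S)
    (hsub : IsStructurallySubmodular S) : IsRegularProfile S O := by
  have inf_inv_notMem : ∀ r ∈ O, ∀ s ∈ O, inv r ⊓ inv s ∈ O → r ⊓ inv s ∉ S := by
    intro r hr s hs hcorner hmem
    refine hO.not_subset
      (isNodeStar_triple (hO.subset hr) (hO.subset hs) hmem (hO.subset hcorner)) ?_
    rintro _ (rfl | rfl | rfl)
    · exact hO.mem_of_le hmem hr inf_le_left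
    · exact hs
    · exact hcorner
  refine (isRegularProfile_iff hS).2 ⟨hO.toIsRegularOrientation, fun r hr s hs hcorner => ?_⟩
  rcases hsub.inf_inv_mem_or hS (hO.subset hr) (hO.subset hs) with h | h
  · exact inf_inv_notMem r hr s hs hcorner h
  · exact inf_inv_notMem s hs r hr (by rwa [inf_comm]) h

lemma not_isTangle_isNodeStar (hS : IsSepSystem S) (hsub : IsStructurallySubmodular S)
    (O : Set U) : ¬ IsTangle S {σ | IsNodeStar S σ} O := fun hO =>
  let ⟨_, hσ, hσO⟩ := (hO.isRegularProfile hS hsub).exists_isNodeStar hS hsub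
  hO.not_subset hσ hσO

theorem exists_isOver_isNodeStar (hS : IsSepSystem S) (hsub : IsStructurallySubmodular S) :
    ∃ (V : Type) (_ : Fintype V) (T : STree S V),
      T.IsIrredundant ∧ T.IsOver {σ | IsNodeStar S σ} :=
  (isShiftable_isNodeStar hS).exists_isOver_of_forall_not_isTangle hS hsub
    (not_isTangle_isNodeStar hS hsub)

end NodeStars

namespace STree

variable {U : Type*} [SepUniverse U] {S O : Set U} {V : Type*} (T : STree S V)

lemma isSink_iff {t : V} : T.IsSink O t ↔ T.labelsAt t ⊆ O :=
  ⟨fun h _ ⟨e, he, hs⟩ => hs ▸ h e he, fun h e he => h ⟨e, he, rfl⟩⟩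

/-- Otherwise every vertex has an outgoing edge. These edges are distinct, but a tree has fewer
edges than vertices. -/
lemma exists_isSink [Finite V] (hO : IsRegularOrientation S O) : ∃ t, T.IsSink O t := by
  classical
  have := Fintype.ofFinite V
  by_contra! hno
  have exists_out : ∀ t, ∃ u, ∃ h : T.graph.Adj t u, T.label ⟨(t, u), h⟩ ∈ O := by
    intro t
    have ht := hno t
    simp only [IsSink, not_forall] at ht
    obtain ⟨e, rfl, he⟩ := ht
    have hsymm : T.label e.symm ∈ O := by
      rwa [T.label_symm, hO.inv_mem_iff (T.label_mem e)]
    exact ⟨e.fst, e.symm.adj, hsymm⟩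
  choose next hadj hnext using exists_out
  have hinj : Function.Injective fun v => s(v, next v) := by
    intro v w h
    rcases Sym2.eq_iff.1 h with ⟨hvw, -⟩ | ⟨hvw, hwv⟩
    · exact hvw
    · have hsymm : (⟨(w, next w), hadj w⟩ : T.graph.Dart) =
          (⟨(v, next v), hadj v⟩ : T.graph.Dart).symm :=
        SimpleGraph.Dart.ext _ _ (Prod.ext hwv.symm hvw.symm)
      have hw := hnext w
      rw [hsymm, T.label_symm] at hw
      exact (hO.inv_notMem (hnext v) hw).elim
  have hcard : Fintype.card V ≤ T.graph.edgeFinset.card :=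
    Finset.card_le_card_of_injOn _
      (fun v _ => Finset.mem_coe.2 (SimpleGraph.mem_edgeFinset.2 (hadj v))) hinj.injOn
  exact (hcard.trans_lt ((Nat.lt_succ_self _).trans_eq T.isTree.card_edgeFinset)).false

variable {T}

lemma IsIrredundant.label_le_label (hirr : T.IsIrredundant) (hstar : T.IsOverStars) {u v w : V}
    (huv : T.graph.Adj u v) (hvw : T.graph.Adj v w) (huw : u ≠ w) :
    T.label ⟨(u, v), huv⟩ ≤ T.label ⟨(v, w), hvw⟩ := by
  have h := hstar v _ ⟨⟨(u, v), huv⟩, rfl, rfl⟩ _ ⟨⟨(w, v), hvw.symm⟩, rfl, rfl⟩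
    (hirr _ _ rfl huw)
  rwa [← T.label_symm] at h

lemma IsSink.label_mem (hirr : T.IsIrredundant) (hstar : T.IsOverStars) (hO : IsDownClosedIn S O)
    {u v w : V} (hw : T.IsSink O w) (huv : T.graph.Adj u v) (p : T.graph.Walk v w)
    (hp : (p.cons huv).IsPath) : T.label ⟨(u, v), huv⟩ ∈ O := by
  induction p generalizing u with
  | nil => exact hw _ rfl
  | @cons v b w hvb p ih =>
    have hub : u ≠ b := by
      rintro rfl
      exact (SimpleGraph.Walk.cons_isPath_iff _ _).1 hp |>.2 (by simp)
    exact hO.mem_of_le (T.label_mem _) (ih hw hvb hp.of_cons)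
      (hirr.label_le_label hstar huv hvb hub)

lemma IsSink.eq (hirr : T.IsIrredundant) (hstar : T.IsOverStars) (hO : IsPartialOrientation S O)
    {t t' : V} (ht : T.IsSink O t) (ht' : T.IsSink O t') : t' = t := by
  obtain ⟨p, hp⟩ := (T.isTree.1.preconnected t t').exists_isPath
  cases p with
  | nil => rfl
  | @cons _ v _ htv p =>
    have hout := ht'.label_mem hirr hstar hO.toIsDownClosedIn htv p hp
    have hin : inv (T.label ⟨(t, v), htv⟩) ∈ O := T.label_symm ⟨(t, v), htv⟩ ▸ ht _ rfl
    exact (hO.inv_notMem hout hin).elim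

lemma IsIrredundant.degree_eq_ncard_labelsAt [Fintype V] (hirr : T.IsIrredundant) (t : V) :
    T.degree t = (T.labelsAt t).ncard := by
  classical
  rw [degree, ← SimpleGraph.card_neighborFinset_eq_degree, ← Set.ncard_coe_finset]
  refine Set.ncard_congr
    (fun u hu => T.label ⟨(u, t), ((T.graph.mem_neighborFinset t u).1 hu).symm⟩)
    (fun u hu => ⟨_, rfl, rfl⟩) (fun u v hu hv h => ?_) ?_
  · by_contra hne
    exact hirr ⟨(u, t), _⟩ ⟨(v, t), _⟩ rfl hne h
  · rintro _ ⟨⟨⟨u, _⟩, hu⟩, rfl, rfl⟩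
    exact ⟨u, (T.graph.mem_neighborFinset _ _).2 hu.symm, rfl⟩

section IsOverNodeStars

variable {P : Set U}

lemma IsOver.isOverStars (hT : T.IsOver {σ | IsNodeStar S σ}) : T.IsOverStars :=
  fun t => (hT t).isStar

lemma IsOver.isTreeOfTangles [Finite V] (hT : T.IsOver {σ | IsNodeStar S σ})
    (hirr : T.IsIrredundant) (hS : IsSepSystem S) : T.IsTreeOfTangles := by
  refine ⟨hirr, fun P Q hP hQ hne => ?_⟩
  obtain ⟨t, ht⟩ := T.exists_isSink (hP.isRegularOrientation hS)
  obtain ⟨_, ⟨e, -, rfl⟩, hdist⟩ := (((hT t).isDetermining hP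
    (T.isSink_iff.1 ht)).distinguishesFromOthers hP.orientation.subset).2 Q hQ hne.symm
  exact ⟨e, hdist⟩

lemma IsOver.exists_isNodeOf_degree_eq_delta [Fintype V] (hT : T.IsOver {σ | IsNodeStar S σ})
    (hirr : T.IsIrredundant) (hS : IsSepSystem S) (hP : IsRegularProfile S P) :
    ∃ t, T.IsNodeOf P t ∧ T.degree t = delta S P := by
  have hPO := hP.isRegularOrientation hS
  obtain ⟨t, ht⟩ := T.exists_isSink hPO
  refine ⟨t, ⟨ht, fun t' => ht.eq hirr hT.isOverStars hPO.toIsPartialOrientation⟩, ?_⟩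
  have hsub := T.isSink_iff.1 ht
  rw [hirr.degree_eq_ncard_labelsAt]
  exact ((hT t).ncard_le_delta hP hsub).antisymm
    (((hT t).isDetermining hP hsub).delta_le_ncard hS.finite hPO.subset)

lemma IsOver.exists_maxDegree_eq_delta [Fintype V] (hT : T.IsOver {σ | IsNodeStar S σ})
    (hirr : T.IsIrredundant) (hS : IsSepSystem S) (h : 3 < T.maxDegree) :
    ∃ P, IsRegularProfile S P ∧ T.maxDegree = delta S P := by
  classical
  have := T.isTree.1.nonempty
  obtain ⟨t, ht : T.maxDegree = T.degree t⟩ := T.graph.exists_maximal_degree_vertex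
  rw [hirr.degree_eq_ncard_labelsAt] at ht
  obtain ⟨P, hP, hle⟩ := (hT t).ncard_le.resolve_left (ht ▸ h).not_ge
  obtain ⟨t', -, ht'⟩ := hT.exists_isNodeOf_degree_eq_delta hirr hS hP
  have hmax : T.degree t' ≤ T.maxDegree := T.graph.degree_le_maxDegree t'
  exact ⟨P, hP, (ht.trans_le hle).antisymm (ht' ▸ hmax)⟩

end IsOverNodeStars

end STree

end AbstractSep

theorem mainTheorem7 {U : Type*} [AbstractSep.SepUniverse U] (S : Set U)
    (hS : AbstractSep.IsSepSystem S) (hsub : AbstractSep.IsStructurallySubmodular S) :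
    ∃ (V : Type) (_ : Fintype V) (T : AbstractSep.STree S V),
      T.IsTreeOfTangles ∧ T.IsOverStars ∧
      (∀ P : Set U, AbstractSep.IsRegularProfile S P →
        ∃ t : V, T.IsNodeOf P t ∧ T.degree t = AbstractSep.delta S P) ∧
      (3 < T.maxDegree →
        ∃ P : Set U, AbstractSep.IsRegularProfile S P ∧ T.maxDegree = AbstractSep.delta S P) := by
  obtain ⟨V, _, T, hirr, hT⟩ := AbstractSep.exists_isOver_isNodeStar hS hsub
  exact ⟨V, inferInstance, T, hT.isTreeOfTangles hirr hS, hT.isOverStars,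
    fun _ hP => hT.exists_isNodeOf_degree_eq_delta hirr hS hP,
    hT.exists_maxDegree_eq_delta hirr hS⟩
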